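/- Proposition 3.6 ("$M(G)\subseteq wap(B_p(G))$"). Let $G$ be a locally compact (Hausdorff) group with a fixed left Haar measure $dx$, let $1<p<\infty$ and $\frac1p+\frac1q=1$. Let $A_p(G)$ be the Herz algebra of all functions $u=\sum_{i=1}^\infty g_i*f_i^\vee$ on $G$ with $f_i\in L^p(G)$, $g_i\in L^q(G)$ and $\sum_i\|f_i\|_p\|g_i\|_q<\infty$, where $f^\vee(x)=f(x^{-1})$ and $(g*h)(x)=\int_G g(y)h(y^{-1}x)\,dy$, normed by $\|u\|_{A_p(G)}=\inf\{\sum_i\|f_i\|_p\|g_i\|_q : u=\sum_i g_i*f_i^\vee\}$. Let $B_p(G)$ be the algebra of bounded continuous functions $u:G\to\mathbb C$ such that $uv\in A_p(G)$ for all $v\in A_p(G)$, with pointwise operations and the norm $\|u\|=\sup\{\|uv\|_{A_p(G)}:\|v\|_{A_p(G)}\le 1\}$. For $\phi\in B_p(G)^*$ and $u\in B_p(G)$ define $\phi u\in B_p(G)^*$ by $\langle\phi u,v\rangle=\langle\phi,uv\rangle$; the functional $\phi$ is weakly almost periodic, $\phi\in wap(B_p(G))$, if $\{\phi u: u\in B_p(G),\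 \|u\|\le 1\}$ is relatively compact in the weak topology $\sigma(B_p(G)^*,B_p(G)^{**})$. Then for every bounded complex Borel measure $\mu$ on $G$, every $u\in B_p(G)$ is $\mu$-integrable, and $u\mapsto\int_G u\,d\mu$ is a bounded linear functional on $B_p(G)$ that is weakly almost periodic. -/

import Mathlib

open MeasureTheory Filter Topology
open scoped ENNReal BoundedContinuousFunction

noncomputable section

namespace Herz

section Basic

variable {G : Type*} [Group G] [MeasurableSpace G]

/-- Convolution of functions on a group with left Haar measure `lam`:
`(g * h)(x) = ∫ g(y) h(y⁻¹ x) dy`. -/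
def conv (lam : Measure G) (g h : G → ℂ) (x : G) : ℂ :=
  ∫ y, g y * h (y⁻¹ * x) ∂lam

/-- The reflection `f^∨(x) = f(x⁻¹)`. -/
def check (f : G → ℂ) (x : G) : ℂ := f x⁻¹

/-- The function `u` is given by the series `u(x) = ∑ᵢ (gᵢ * fᵢ^∨)(x)` with `fᵢ ∈ L^p`, `gᵢ ∈ L^q`
and `∑ᵢ ‖fᵢ‖_p ‖gᵢ‖_q < ∞`. The index type is `ℕ` in the definition of the Herz algebra. -/
structure IsRep (lam : Measure G) (p q : ℝ≥0∞) {ι : Type} (u : G → ℂ)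
    (f : ι → Lp ℂ p lam) (g : ι → Lp ℂ q lam) : Prop where
  summable : Summable fun i => ‖f i‖ * ‖g i‖
  hasSum : ∀ x, HasSum (fun i => conv lam (g i) (check (f i)) x) (u x)

theorem IsRep.exists_nat {lam : Measure G} {p q : ℝ≥0∞} {ι : Type} [Denumerable ι] {u : G → ℂ}
    {f : ι → Lp ℂ p lam} {g : ι → Lp ℂ q lam} (h : IsRep lam p q u f g) :
    ∃ (f' : ℕ → Lp ℂ p lam) (g' : ℕ → Lp ℂ q lam), IsRep lam p q u f' g' ∧
      ∑' i, ‖f' i‖ * ‖g' i‖ = ∑' i, ‖f i‖ * ‖g i‖ := by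
  let e := (Denumerable.eqv ι).symm
  refine ⟨f ∘ e, g ∘ e, ⟨(e.summable_iff (f := fun i => ‖f i‖ * ‖g i‖)).2 h.summable, fun x => ?_⟩,
    e.tsum_eq (fun i => ‖f i‖ * ‖g i‖)⟩
  exact (e.hasSum_iff (f := fun i => conv lam (g i) (check (f i)) x)).2 (h.hasSum x)

theorem conv_smul (lam : Measure G) {p q : ℝ≥0∞} (c : ℂ) (f : Lp ℂ p lam) (g : Lp ℂ q lam)
    (x : G) : conv lam (c • g : Lp ℂ q lam) (check f) x = c * conv lam g (check f) x := by
  unfold conv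
  rw [← integral_const_mul]
  apply integral_congr_ae
  filter_upwards [Lp.coeFn_smul c g] with y hy
  simp [hy, mul_assoc]

theorem IsRep.smul {lam : Measure G} {p q : ℝ≥0∞} {ι : Type} {u : G → ℂ}
    {f : ι → Lp ℂ p lam} {g : ι → Lp ℂ q lam} (h : IsRep lam p q u f g) (c : ℂ) :
    IsRep lam p q (c • u) f (fun i => c • g i) ∧
      ∑' i, ‖f i‖ * ‖c • g i‖ = ‖c‖ * ∑' i, ‖f i‖ * ‖g i‖ := by
  have e : ∀ i, ‖f i‖ * ‖c • g i‖ = ‖c‖ * (‖f i‖ * ‖g i‖) := fun i => by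
    have : ‖c • g i‖ = ‖c‖ * ‖g i‖ := by
      rw [Lp.norm_def, Lp.norm_def, eLpNorm_congr_ae (Lp.coeFn_smul c (g i)),
        eLpNorm_const_smul, ENNReal.toReal_mul, toReal_enorm]
    rw [this]; ring
  refine ⟨⟨?_, fun x => ?_⟩, ?_⟩
  · simp_rw [e]; exact h.summable.mul_left _
  · simp_rw [conv_smul]; exact (h.hasSum x).mul_left c
  · simp_rw [e]; exact tsum_mul_left

theorem IsRep.add {lam : Measure G} {p q : ℝ≥0∞} {ι κ : Type} {u v : G → ℂ}
    {f : ι → Lp ℂ p lam} {g : ι → Lp ℂ q lam} (h : IsRep lam p q u f g)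
    {f' : κ → Lp ℂ p lam} {g' : κ → Lp ℂ q lam} (h' : IsRep lam p q v f' g') :
    IsRep lam p q (u + v) (Sum.elim f f') (Sum.elim g g') ∧
      ∑' i, ‖Sum.elim f f' i‖ * ‖Sum.elim g g' i‖ =
        ∑' i, ‖f i‖ * ‖g i‖ + ∑' i, ‖f' i‖ * ‖g' i‖ := by
  have H : HasSum (fun i => ‖Sum.elim f f' i‖ * ‖Sum.elim g g' i‖)
      (∑' i, ‖f i‖ * ‖g i‖ + ∑' i, ‖f' i‖ * ‖g' i‖) :=
    HasSum.sum h.summable.hasSum h'.summable.hasSum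
  refine ⟨⟨H.summable, fun x => ?_⟩, H.tsum_eq⟩
  exact HasSum.sum (h.hasSum x) (h'.hasSum x)

theorem isRep_zero (lam : Measure G) (p q : ℝ≥0∞) :
    IsRep lam p q (0 : G → ℂ) (fun _ : ℕ => 0) (fun _ => 0) := by
  refine ⟨by simp, fun x => ?_⟩
  have : conv lam ((0 : Lp ℂ q lam) : G → ℂ) (check ((0 : Lp ℂ p lam) : G → ℂ)) x = 0 := by
    simpa using conv_smul lam (0 : ℂ) (0 : Lp ℂ p lam) (0 : Lp ℂ q lam) x
  simp only [this]
  exact hasSum_zero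

/-- The Herz algebra `A_p(G)` as a linear space of functions: all `u = ∑ᵢ gᵢ * fᵢ^∨` with
`fᵢ ∈ L^p(G)`, `gᵢ ∈ L^q(G)` and `∑ᵢ ‖fᵢ‖_p ‖gᵢ‖_q < ∞`. -/
def herzSubmodule (lam : Measure G) (p q : ℝ≥0∞) : Submodule ℂ (G → ℂ) where
  carrier := {u | ∃ (f : ℕ → Lp ℂ p lam) (g : ℕ → Lp ℂ q lam), IsRep lam p q u f g}
  zero_mem' := ⟨_, _, isRep_zero lam p q⟩
  add_mem' := by
    rintro u v ⟨f, g, h⟩ ⟨f', g', h'⟩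
    obtain ⟨F, G', H, -⟩ := (h.add h').1.exists_nat
    exact ⟨F, G', H⟩
  smul_mem' := by
    rintro c u ⟨f, g, h⟩
    exact ⟨_, _, (h.smul c).1⟩

/-- The Herz algebra `A_p(G)` as a type, which carries the norm below
(and not the topology of pointwise convergence). -/
def Ap (lam : Measure G) (p q : ℝ≥0∞) : Type _ := ↥(herzSubmodule lam p q)

namespace Ap

variable {lam : Measure G} {p q : ℝ≥0∞}

instance : AddCommGroup (Ap lam p q) := inferInstanceAs (AddCommGroup ↥(herzSubmodule lam p q))
instance : Module ℂ (Ap lam p q) := inferInstanceAs (Module ℂ ↥(herzSubmodule lam p q))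

/-- The function on `G` underlying an element of `A_p(G)`. -/
def toFun : Ap lam p q →ₗ[ℂ] (G → ℂ) := (herzSubmodule lam p q).subtype

theorem toFun_injective : Function.Injective (toFun : Ap lam p q → G → ℂ) :=
  Subtype.val_injective

theorem toFun_mem (v : Ap lam p q) : toFun v ∈ herzSubmodule lam p q := Subtype.property v

/-- `‖u‖ = inf {∑ᵢ ‖fᵢ‖_p ‖gᵢ‖_q : u = ∑ᵢ gᵢ * fᵢ^∨}`. -/
instance : Norm (Ap lam p q) where
  norm u := sInf {r : ℝ | ∃ (f : ℕ → Lp ℂ p lam) (g : ℕ → Lp ℂ q lam),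
    IsRep lam p q (toFun u) f g ∧ r = ∑' i, ‖f i‖ * ‖g i‖}

theorem norm_def (u : Ap lam p q) : ‖u‖ = sInf {r : ℝ |
    ∃ (f : ℕ → Lp ℂ p lam) (g : ℕ → Lp ℂ q lam),
      IsRep lam p q (toFun u) f g ∧ r = ∑' i, ‖f i‖ * ‖g i‖} := rfl

theorem norm_le_of_isRep (u : Ap lam p q) {ι : Type} [Denumerable ι] {f : ι → Lp ℂ p lam}
    {g : ι → Lp ℂ q lam} (h : IsRep lam p q (toFun u) f g) : ‖u‖ ≤ ∑' i, ‖f i‖ * ‖g i‖ := by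
  obtain ⟨f', g', h', e⟩ := h.exists_nat
  rw [← e, norm_def]
  refine csInf_le ⟨0, ?_⟩ ⟨f', g', h', rfl⟩
  rintro _ ⟨f, g, -, rfl⟩
  exact tsum_nonneg fun i => mul_nonneg ENNReal.toReal_nonneg ENNReal.toReal_nonneg

theorem exists_isRep_lt (u : Ap lam p q) {ε : ℝ} (hε : 0 < ε) :
    ∃ (f : ℕ → Lp ℂ p lam) (g : ℕ → Lp ℂ q lam), IsRep lam p q (toFun u) f g ∧
      ∑' i, ‖f i‖ * ‖g i‖ < ‖u‖ + ε := by
  obtain ⟨f, g, h⟩ := toFun_mem u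
  obtain ⟨_, ⟨f', g', h', rfl⟩, hlt⟩ := exists_lt_of_csInf_lt (s := {r : ℝ |
    ∃ (f : ℕ → Lp ℂ p lam) (g : ℕ → Lp ℂ q lam),
      IsRep lam p q (toFun u) f g ∧ r = ∑' i, ‖f i‖ * ‖g i‖}) ⟨_, f, g, h, rfl⟩
      (lt_add_of_pos_right ‖u‖ hε)
  exact ⟨f', g', h', hlt⟩

theorem norm_smul_le' (c : ℂ) (u : Ap lam p q) : ‖c • u‖ ≤ ‖c‖ * ‖u‖ := by
  refine le_of_forall_pos_lt_add fun ε hε => ?_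
  have hc : 0 < ‖c‖ + 1 := by positivity
  obtain ⟨f, g, h, hlt⟩ := exists_isRep_lt u (div_pos hε hc)
  have h1 : IsRep lam p q (toFun (c • u)) f (fun i => c • g i) := by
    rw [map_smul]; exact (h.smul c).1
  calc ‖c • u‖ ≤ ‖c‖ * ∑' i, ‖f i‖ * ‖g i‖ := (h.smul c).2 ▸ norm_le_of_isRep _ h1
    _ ≤ ‖c‖ * (‖u‖ + ε / (‖c‖ + 1)) := by gcongr
    _ = ‖c‖ * ‖u‖ + ε * (‖c‖ / (‖c‖ + 1)) := by ring
    _ < ‖c‖ * ‖u‖ + ε := by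
      have : ‖c‖ / (‖c‖ + 1) < 1 := by rw [div_lt_one hc]; linarith
      nlinarith

end Ap

end Basic

section Normed

variable {G : Type*} [Group G] [TopologicalSpace G] [IsTopologicalGroup G]
  [MeasurableSpace G] [BorelSpace G]
  {lam : Measure G} [lam.IsHaarMeasure] {p q : ℝ≥0∞} [hpq : p.HolderConjugate q]

theorem norm_conv_le (f : Lp ℂ p lam) (g : Lp ℂ q lam) (x : G) :
    ‖conv lam g (check f) x‖ ≤ ‖f‖ * ‖g‖ := by
  have hmp : MeasurePreserving (fun y => x⁻¹ * y) lam lam := measurePreserving_mul_left lam x⁻¹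
  set F : Lp ℂ p lam := Lp.compMeasurePreserving _ hmp f with hF
  have hFn : ‖F‖ = ‖f‖ := Lp.norm_compMeasurePreserving f hmp
  have hc : conv lam g (check f) x = ∫ y, (F : G → ℂ) y • (g : G → ℂ) y ∂lam := by
    apply integral_congr_ae
    filter_upwards [Lp.coeFn_compMeasurePreserving f hmp] with y hy
    rw [hF, hy]
    simp [check, mul_comm]
  have h1 := eLpNorm_smul_le_mul_eLpNorm (r := 1) (p := p) (q := q)
    (Lp.aestronglyMeasurable g) (Lp.aestronglyMeasurable F)
  rw [hc, ← hFn, Lp.norm_def, Lp.norm_def, ← ENNReal.toReal_mul]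
  refine (norm_integral_le_lintegral_norm _).trans (ENNReal.toReal_mono
    (ENNReal.mul_ne_top (Lp.eLpNorm_ne_top F) (Lp.eLpNorm_ne_top g)) ?_)
  refine le_trans (le_of_eq ?_) h1
  simp [eLpNorm_one_eq_lintegral_enorm]

namespace Ap

theorem norm_toFun_le (u : Ap lam p q) (x : G) : ‖toFun u x‖ ≤ ‖u‖ := by
  refine le_of_forall_pos_lt_add fun ε hε => ?_
  obtain ⟨f, g, h, hlt⟩ := exists_isRep_lt u hε
  refine lt_of_le_of_lt ?_ hlt
  rw [← (h.hasSum x).tsum_eq]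
  exact tsum_of_norm_bounded h.summable.hasSum fun i => norm_conv_le _ _ _

/-- The sum of a normwise summable sequence in `A_p(G)`. -/
theorem exists_sum (u : ℕ → Ap lam p q) (hu : Summable fun n => ‖u n‖) :
    ∃ U : Ap lam p q, (∀ x, HasSum (fun n => toFun (u n) x) (toFun U x)) ∧
      ‖U‖ ≤ ∑' n, ‖u n‖ := by
  have key : ∀ ε > 0, ∃ U : Ap lam p q, (∀ x, HasSum (fun n => toFun (u n) x) (toFun U x)) ∧
      ‖U‖ ≤ ∑' n, ‖u n‖ + ε := by
    intro ε hε
    choose f g h hlt using fun n => exists_isRep_lt (u n)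
      (show 0 < ε / 2 / 2 ^ n by positivity)
    have hgeo : HasSum (fun n => ε / 2 / 2 ^ n) ε := hasSum_geometric_two' ε
    have hn0 : ∀ x : ℕ × ℕ, 0 ≤ ‖f x.1 x.2‖ * ‖g x.1 x.2‖ := fun x =>
      mul_nonneg ENNReal.toReal_nonneg ENNReal.toReal_nonneg
    have hs1 : Summable fun n => ∑' i, ‖f n i‖ * ‖g n i‖ :=
      Summable.of_nonneg_of_le (fun n => tsum_nonneg fun i => hn0 (n, i)) (fun n => (hlt n).le)
        (hu.add hgeo.summable)
    have hs : Summable fun x : ℕ × ℕ => ‖f x.1 x.2‖ * ‖g x.1 x.2‖ :=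
      (summable_prod_of_nonneg hn0).2 ⟨fun n => (h n).summable, hs1⟩
    have hle : ∑' x : ℕ × ℕ, ‖f x.1 x.2‖ * ‖g x.1 x.2‖ ≤ ∑' n, ‖u n‖ + ε := by
      rw [hs.tsum_prod, ← hgeo.tsum_eq, ← hu.tsum_add hgeo.summable]
      exact hs1.tsum_le_tsum (fun n => (hlt n).le) (hu.add hgeo.summable)
    have hrep : IsRep lam p q
        (fun x => ∑' i : ℕ × ℕ, conv lam (g i.1 i.2) (check (f i.1 i.2)) x)
        (fun i : ℕ × ℕ => f i.1 i.2) (fun i : ℕ × ℕ => g i.1 i.2) :=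
      ⟨hs, fun x => (Summable.of_norm_bounded hs fun i => norm_conv_le _ _ _).hasSum⟩
    obtain ⟨f', g', h', -⟩ := hrep.exists_nat
    let U : Ap lam p q := ⟨_, f', g', h'⟩
    refine ⟨U, fun x => ?_, (norm_le_of_isRep U hrep).trans hle⟩
    exact (hrep.hasSum x).prod_fiberwise fun n => (h n).hasSum x
  obtain ⟨U, hU, -⟩ := key 1 one_pos
  refine ⟨U, hU, le_of_forall_pos_le_add fun ε hε => ?_⟩
  obtain ⟨V, hV, hle⟩ := key ε hε
  have : U = V := toFun_injective (funext fun x => (hU x).unique (hV x))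
  exact this ▸ hle

theorem core : NormedSpace.Core ℂ (Ap lam p q) where
  norm_nonneg u := by
    rw [norm_def]
    refine Real.sInf_nonneg ?_
    rintro _ ⟨f, g, -, rfl⟩
    exact tsum_nonneg fun i => mul_nonneg ENNReal.toReal_nonneg ENNReal.toReal_nonneg
  norm_smul c u := by
    refine le_antisymm (norm_smul_le' c u) ?_
    rcases eq_or_ne c 0 with rfl | hc
    · rw [norm_zero, zero_mul, norm_def]
      refine Real.sInf_nonneg ?_
      rintro _ ⟨f, g, -, rfl⟩
      exact tsum_nonneg fun i => mul_nonneg ENNReal.toReal_nonneg ENNReal.toReal_nonneg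
    · have := norm_smul_le' c⁻¹ (c • u)
      rw [smul_smul, inv_mul_cancel₀ hc, one_smul, norm_inv] at this
      have h0 : 0 < ‖c‖ := norm_pos_iff.2 hc
      calc ‖c‖ * ‖u‖ ≤ ‖c‖ * (‖c‖⁻¹ * ‖c • u‖) := by gcongr
        _ = ‖c • u‖ := by rw [mul_inv_cancel_left₀ h0.ne']
  norm_triangle u v := by
    refine le_of_forall_pos_lt_add fun ε hε => ?_
    obtain ⟨f, g, h, hlt⟩ := exists_isRep_lt u (half_pos hε)
    obtain ⟨f', g', h', hlt'⟩ := exists_isRep_lt v (half_pos hε)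
    have h1 : IsRep lam p q (toFun (u + v)) (Sum.elim f f') (Sum.elim g g') := by
      rw [map_add]; exact (h.add h').1
    have h2 := norm_le_of_isRep _ h1
    rw [(h.add h').2] at h2
    linarith
  norm_eq_zero_iff u := by
    constructor
    · intro h
      apply toFun_injective
      ext x
      have := norm_toFun_le u x
      rw [h] at this
      simpa using this
    · rintro rfl
      have := norm_smul_le' (0 : ℂ) (0 : Ap lam p q)
      rw [norm_zero, zero_mul, smul_zero] at this
      refine le_antisymm this ?_
      rw [norm_def]
      refine Real.sInf_nonneg ?_
      rintro _ ⟨f, g, -, rfl⟩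
      exact tsum_nonneg fun i => mul_nonneg ENNReal.toReal_nonneg ENNReal.toReal_nonneg

instance : NormedAddCommGroup (Ap lam p q) := NormedAddCommGroup.ofCore core
instance : NormedSpace ℂ (Ap lam p q) := NormedSpace.ofCore core

instance : CompleteSpace (Ap lam p q) := by
  apply NormedAddCommGroup.completeSpace_of_summable_imp_tendsto
  intro u hu
  obtain ⟨U, hU, -⟩ := exists_sum u hu
  refine ⟨U, ?_⟩
  rw [tendsto_iff_norm_sub_tendsto_zero]
  refine squeeze_zero (fun _ => norm_nonneg _) (fun N => ?_)
    (tendsto_sum_nat_add fun n => ‖u n‖)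
  obtain ⟨V, hV, hle⟩ := exists_sum (fun n => u (n + N)) ((summable_nat_add_iff N).2 hu)
  have : U - ∑ i ∈ Finset.range N, u i = V := by
    apply toFun_injective
    ext x
    refine HasSum.unique ?_ (hV x)
    have := (hasSum_nat_add_iff' N).2 (hU x)
    simpa [map_sub, map_sum] using this
  rw [norm_sub_rev, this]
  exact hle

theorem exists_toFun_ne_zero [LocallyCompactSpace G] (x : G) :
    ∃ v : Ap lam p q, toFun v x ≠ 0 := by
  obtain ⟨K, hK, hK1⟩ := exists_compact_mem_nhds (1 : G)
  set U := interior K with hU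
  have hUo : IsOpen U := isOpen_interior
  have hUm : MeasurableSet U := hUo.measurableSet
  have h1U : (1 : G) ∈ U := mem_interior_iff_mem_nhds.2 hK1
  have hUfin : lam U ≠ ∞ := (measure_mono interior_subset).trans_lt hK.measure_lt_top |>.ne
  have hU0 : lam U ≠ 0 := (hUo.measure_pos lam ⟨1, h1U⟩).ne'
  have hmp : MeasurePreserving (fun y => x⁻¹ * y) lam lam := measurePreserving_mul_left lam x⁻¹
  let f : Lp ℂ p lam := indicatorConstLp p hUm hUfin 1
  let g0 : Lp ℂ q lam := indicatorConstLp q hUm hUfin 1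
  let g : Lp ℂ q lam := Lp.compMeasurePreserving _ hmp g0
  let F : ℕ → Lp ℂ p lam := Pi.single 0 f
  let K : ℕ → Lp ℂ q lam := Pi.single 0 g
  have hF : ∀ i, i ≠ 0 → F i = 0 := fun i hi => Pi.single_eq_of_ne hi _
  have hz : ∀ z, conv lam ((0 : Lp ℂ q lam) : G → ℂ) (check ((0 : Lp ℂ p lam) : G → ℂ)) z = 0 :=
    fun z => by simpa using conv_smul lam (0 : ℂ) (0 : Lp ℂ p lam) (0 : Lp ℂ q lam) z
  have hK' : ∀ i, i ≠ 0 → K i = 0 := fun i hi => Pi.single_eq_of_ne hi _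
  have hrep : IsRep lam p q (fun z => conv lam (K 0) (check (F 0)) z) F K := by
    refine ⟨(hasSum_single (f := fun i => ‖F i‖ * ‖K i‖) 0 fun i hi => ?_).summable, fun z =>
      hasSum_single (f := fun i => conv lam (K i) (check (F i)) z) 0 fun i hi => ?_⟩
    · simp [hF i hi]
    · rw [hF i hi, hK' i hi]
      exact hz z
  refine ⟨⟨_, F, K, hrep⟩, ?_⟩
  change conv lam (K 0) (check (F 0)) x ≠ 0
  have e : conv lam (K 0) (check (F 0)) x =
      ∫ y, U.indicator (fun _ => (1 : ℂ)) (x⁻¹ * y) ∂lam := by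
    apply integral_congr_ae
    have a1 : ∀ᵐ y ∂lam, (f : G → ℂ) (x⁻¹ * y) = U.indicator (fun _ => (1 : ℂ)) (x⁻¹ * y) :=
      hmp.quasiMeasurePreserving.ae indicatorConstLp_coeFn
    have a2 : ∀ᵐ y ∂lam, (g0 : G → ℂ) (x⁻¹ * y) = U.indicator (fun _ => (1 : ℂ)) (x⁻¹ * y) :=
      hmp.quasiMeasurePreserving.ae indicatorConstLp_coeFn
    filter_upwards [a1, a2, Lp.coeFn_compMeasurePreserving g0 hmp] with y h1 h2 h3
    have e1 : (g : G → ℂ) y = U.indicator (fun _ => (1 : ℂ)) (x⁻¹ * y) := by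
      rw [← h2]; exact h3
    have e2 : check (f : G → ℂ) (y⁻¹ * x) = U.indicator (fun _ => (1 : ℂ)) (x⁻¹ * y) := by
      rw [← h1]; simp [check]
    have : (K 0) = g := Pi.single_eq_same _ _
    rw [this]
    have : (F 0) = f := Pi.single_eq_same _ _
    rw [this, e1, e2]
    by_cases hy : x⁻¹ * y ∈ U <;> simp [hy]
  rw [e, integral_mul_left_eq_self (fun y => U.indicator (fun _ => (1 : ℂ)) y) x⁻¹,
    integral_indicator hUm]
  simp [Measure.real, ENNReal.toReal_eq_zero_iff, hU0, hUfin]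

end Ap

end Normed

section Multipliers

/-- The multipliers of the Herz algebra: bounded continuous functions `u : G → ℂ` with
`u v ∈ A_p(G)` for all `v ∈ A_p(G)`. -/
def multiplierSubalgebra {G : Type*} [Group G] [TopologicalSpace G] [MeasurableSpace G]
    (lam : Measure G) (p q : ℝ≥0∞) : Subalgebra ℂ (G →ᵇ ℂ) where
  carrier := {u | ∀ v ∈ herzSubmodule lam p q, (u : G → ℂ) * v ∈ herzSubmodule lam p q}
  mul_mem' := by
    intro u w hu hw v hv
    have : ((u * w : G →ᵇ ℂ) : G → ℂ) * v = (u : G → ℂ) * ((w : G → ℂ) * v) := by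
      ext x; simp [mul_assoc]
    rw [this]
    exact hu _ (hw _ hv)
  add_mem' := by
    intro u w hu hw v hv
    have : ((u + w : G →ᵇ ℂ) : G → ℂ) * v = (u : G → ℂ) * v + (w : G → ℂ) * v := by
      ext x; simp [add_mul]
    rw [this]
    exact Submodule.add_mem _ (hu _ hv) (hw _ hv)
  algebraMap_mem' := by
    intro c v hv
    have : ((algebraMap ℂ (G →ᵇ ℂ) c : G →ᵇ ℂ) : G → ℂ) * v = c • v := by
      ext x; simp [Algebra.algebraMap_eq_smul_one]
    rw [this]
    exact Submodule.smul_mem _ _ hv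

/-- The algebra `B_p(G)` of pointwise multipliers of `A_p(G)` as a type, which carries the
multiplier norm below (and not the supremum norm). -/
def Bp {G : Type*} [Group G] [TopologicalSpace G] [MeasurableSpace G]
    (lam : Measure G) (p q : ℝ≥0∞) : Type _ := ↥(multiplierSubalgebra lam p q)

namespace Bp

section

variable {G : Type*} [Group G] [TopologicalSpace G] [MeasurableSpace G]
  {lam : Measure G} {p q : ℝ≥0∞}

instance : CommRing (Bp lam p q) := inferInstanceAs (CommRing ↥(multiplierSubalgebra lam p q))
instance : Algebra ℂ (Bp lam p q) :=
  inferInstanceAs (Algebra ℂ ↥(multiplierSubalgebra lam p q))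

/-- The bounded continuous function underlying a multiplier. -/
def toBCF : Bp lam p q →ₐ[ℂ] (G →ᵇ ℂ) := (multiplierSubalgebra lam p q).val

instance : CoeFun (Bp lam p q) fun _ => G → ℂ := ⟨fun u => ⇑(toBCF u)⟩

theorem toBCF_injective : Function.Injective (toBCF : Bp lam p q → (G →ᵇ ℂ)) :=
  Subtype.val_injective

theorem mul_mem (u : Bp lam p q) {v : G → ℂ} (hv : v ∈ herzSubmodule lam p q) :
    (u : G → ℂ) * v ∈ herzSubmodule lam p q := Subtype.property u v hv

/-- The linear map `v ↦ u v` on `A_p(G)`. -/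
def mulLin (u : Bp lam p q) : Ap lam p q →ₗ[ℂ] Ap lam p q where
  toFun v := ⟨(u : G → ℂ) * Ap.toFun v, u.mul_mem (Ap.toFun_mem v)⟩
  map_add' v w := Ap.toFun_injective (mul_add (u : G → ℂ) (Ap.toFun v) (Ap.toFun w))
  map_smul' c v := Ap.toFun_injective (mul_smul_comm c (u : G → ℂ) (Ap.toFun v))

theorem toFun_mulLin (u : Bp lam p q) (v : Ap lam p q) (x : G) :
    Ap.toFun (mulLin u v) x = u x * Ap.toFun v x := rfl

end

variable {G : Type*} [Group G] [TopologicalSpace G] [IsTopologicalGroup G]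
  [MeasurableSpace G] [BorelSpace G]
  {lam : Measure G} [lam.IsHaarMeasure] {p q : ℝ≥0∞} [hpq : p.HolderConjugate q]

/-- The map `v ↦ u v` on `A_p(G)`, which is bounded by the closed graph theorem. -/
def mulCLM (u : Bp lam p q) : Ap lam p q →L[ℂ] Ap lam p q :=
  ContinuousLinearMap.ofSeqClosedGraph (g := mulLin u) fun w v y hv hy => by
    have ev : ∀ x, Tendsto (fun n => Ap.toFun (w n) x) atTop (𝓝 (Ap.toFun v x)) := fun x => by
      rw [tendsto_iff_norm_sub_tendsto_zero] at hv ⊢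
      refine squeeze_zero (fun _ => norm_nonneg _) (fun n => ?_) hv
      simpa using Ap.norm_toFun_le (w n - v) x
    have ey : ∀ x, Tendsto (fun n => u x * Ap.toFun (w n) x) atTop (𝓝 (Ap.toFun y x)) :=
      fun x => by
        rw [tendsto_iff_norm_sub_tendsto_zero] at hy ⊢
        refine squeeze_zero (fun _ => norm_nonneg _) (fun n => ?_) hy
        simpa [toFun_mulLin] using Ap.norm_toFun_le (mulLin u (w n) - y) x
    apply Ap.toFun_injective
    ext x
    exact tendsto_nhds_unique (ey x) ((ev x).const_mul (u x))

theorem toFun_mulCLM (u : Bp lam p q) (v : Ap lam p q) (x : G) :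
    Ap.toFun (mulCLM u v) x = u x * Ap.toFun v x := rfl

/-- The representation of `B_p(G)` by multiplication operators on `A_p(G)`. -/
def mulHom : Bp lam p q →ₐ[ℂ] (Ap lam p q →L[ℂ] Ap lam p q) where
  toFun := mulCLM
  map_one' := by
    ext1 v; apply Ap.toFun_injective; ext x; simp [toFun_mulCLM]
  map_mul' u w := by
    ext1 v; apply Ap.toFun_injective; ext x; simp [toFun_mulCLM, mul_assoc]
  map_zero' := by
    ext1 v; apply Ap.toFun_injective; ext x; simp [toFun_mulCLM]
  map_add' u w := by
    ext1 v; apply Ap.toFun_injective; ext x; simp [toFun_mulCLM, add_mul]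
  commutes' c := by
    ext1 v; apply Ap.toFun_injective; ext x
    simp [toFun_mulCLM, Algebra.algebraMap_eq_smul_one]

variable [LocallyCompactSpace G]

theorem mulHom_injective :
    Function.Injective (mulHom : Bp lam p q → (Ap lam p q →L[ℂ] Ap lam p q)) := by
  intro u w h
  apply toBCF_injective
  ext x
  obtain ⟨v, hv⟩ := Ap.exists_toFun_ne_zero (lam := lam) (p := p) (q := q) x
  have h1 : mulCLM u v = mulCLM w v := DFunLike.congr_fun h v
  have h2 := congrFun (congrArg Ap.toFun h1) x
  rw [toFun_mulCLM, toFun_mulCLM] at h2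
  exact mul_right_cancel₀ hv h2

/-- The norm of `B_p(G)` is the norm of the multiplication operator on `A_p(G)`, see
`norm_eq_sSup`. -/
instance : NormedCommRing (Bp lam p q) :=
  NormedCommRing.induced (Bp lam p q) (Ap lam p q →L[ℂ] Ap lam p q) mulHom mulHom_injective

instance : NormedAlgebra ℂ (Bp lam p q) :=
  NormedAlgebra.induced ℂ (Bp lam p q) (Ap lam p q →L[ℂ] Ap lam p q) mulHom

/-- `‖u‖ = sup {‖u v‖ : v ∈ A_p(G), ‖v‖ ≤ 1}`. -/
theorem norm_eq_sSup (u : Bp lam p q) :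
    ‖u‖ = sSup {r : ℝ | ∃ v : Ap lam p q, ‖v‖ ≤ 1 ∧ r = ‖mulLin u v‖} := by
  change ‖mulCLM u‖ = _
  rw [← (mulCLM u).sSup_unitClosedBall_eq_norm]
  congr 1
  ext r
  simp only [Set.mem_image, Metric.mem_closedBall, dist_zero_right, Set.mem_ofPred_eq]
  exact ⟨fun ⟨v, hv, h⟩ => ⟨v, hv, h.symm⟩, fun ⟨v, hv, h⟩ => ⟨v, hv, h.symm⟩⟩

end Bp

end Multipliers

section WeaklyAlmostPeriodic

variable {A : Type*} [NormedCommRing A] [NormedAlgebra ℂ A]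

/-- The module action of a commutative normed algebra on its dual: `⟨φ·u, v⟩ = ⟨φ, u v⟩`. -/
def dualAct (φ : StrongDual ℂ A) (u : A) : StrongDual ℂ A :=
  φ.comp (ContinuousLinearMap.mul ℂ A u)

/-- `wap(A)`: the functionals `φ ∈ A*` whose orbit `{φ·u : ‖u‖ ≤ 1}` is relatively compact for
the weak topology `σ(A*, A**)` of `A*`. -/
def wap (A : Type*) [NormedCommRing A] [NormedAlgebra ℂ A] : Set (StrongDual ℂ A) :=
  {φ | IsCompact (closure (toWeakSpace ℂ (StrongDual ℂ A) '' (dualAct φ '' {u : A | ‖u‖ ≤ 1})))}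

end WeaklyAlmostPeriodic

end Herz

end

/-! Only two facts about `Bp` matter: its elements are bounded continuous functions under pointwise
multiplication, and its norm dominates the supremum norm (`Bp.norm_toBCF_le`). Let ν be the
variation of μ, a finite measure, and Λ the functional that μ induces on L¹(ν). The inclusion into
bounded continuous functions followed by the map to L²(ν) is a bounded operator T, and ⟨φu, v⟩ =
Λ(uv) = Λ(Tu · Tv), since a product of two L² functions lies in L¹.

Hence the orbit map u ↦ φu factors as S ∘ T through the Hilbert space L²(ν). Balls of a Hilbert
space are weakly compact and a bounded operator is weakly continuous, so S sends the ball of radius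
‖T‖ to a weakly compact set, which contains the orbit of the unit ball. This is
`mem_wap_of_factor_L1`. -/

namespace Herz

/-! ### Weak compactness through a Hilbert space. -/

section WeakCompactness

/-- A bounded operator from a Hilbert space maps closed balls to weakly compact sets. -/
theorem isCompact_toWeakSpace_image_closedBall {H F : Type*}
    [NormedAddCommGroup H] [InnerProductSpace ℂ H] [CompleteSpace H]
    [NormedAddCommGroup F] [NormedSpace ℂ F] (S : H →L[ℂ] F) (r : ℝ) :
    IsCompact (toWeakSpace ℂ F '' (S '' Metric.closedBall 0 r)) := by
  -- The Riesz isometry carries closed balls of the dual to closed balls of `H`, so Banach–Alaoglu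
  -- gives the claim once S composed with it is continuous from the weak-star to the weak topology.
  let J : WeakDual ℂ H → WeakSpace ℂ F := fun ψ =>
    toWeakSpace ℂ F (S ((InnerProductSpace.toDual ℂ H).symm (WeakDual.toStrongDual ψ)))
  have hJ : Continuous J := by
    refine WeakBilin.continuous_of_continuous_eval _ fun l => ?_
    -- The vector `z` represents `l ∘ S`. The Riesz map is antilinear, so testing `J ψ` against `l`
    -- gives the conjugate of `ψ z`, which is still weak-star continuous in `ψ`.
    set z : H := (InnerProductSpace.toDual ℂ H).symm (l.comp S)
    have h : ∀ ψ : WeakDual ℂ H,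
        l (S ((InnerProductSpace.toDual ℂ H).symm (WeakDual.toStrongDual ψ))) =
          starRingEnd ℂ (ψ z) := fun ψ => by
      have h1 : l (S ((InnerProductSpace.toDual ℂ H).symm (WeakDual.toStrongDual ψ))) =
          inner ℂ z ((InnerProductSpace.toDual ℂ H).symm (WeakDual.toStrongDual ψ)) :=
        (InnerProductSpace.toDual_symm_apply (y := l.comp S)).symm
      rw [h1, ← inner_conj_symm, InnerProductSpace.toDual_symm_apply]
      rfl
    change Continuous fun ψ : WeakDual ℂ H =>
      l (S ((InnerProductSpace.toDual ℂ H).symm (WeakDual.toStrongDual ψ)))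
    simp_rw [h]
    exact Complex.continuous_conj.comp (WeakDual.eval_continuous z)
  convert (WeakDual.isCompact_closedBall (𝕜 := ℂ) (E := H) 0 r).image hJ using 1
  ext y
  constructor
  · rintro ⟨_, ⟨w, hw, rfl⟩, rfl⟩
    refine ⟨StrongDual.toWeakDual (InnerProductSpace.toDual ℂ H w), ?_, ?_⟩
    · simpa using hw
    · simp [J]
  · rintro ⟨ψ, hψ, rfl⟩
    refine ⟨_, ⟨(InnerProductSpace.toDual ℂ H).symm (WeakDual.toStrongDual ψ), ?_, rfl⟩, rfl⟩
    simpa using hψ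

end WeakCompactness

/-! ### Complex measures and their variation. -/

section Variation

variable {X : Type*} [MeasurableSpace X]

/-- The real and imaginary parts are signed measures, whose total variations are finite by the
Jordan decomposition. Their sum dominates ‖μ E‖ on every set, hence dominates the variation. -/
theorem isFiniteMeasure_variation_complexMeasure (μ : ComplexMeasure X) :
    IsFiniteMeasure μ.variation := by
  refine isFiniteMeasure_of_le (μ.re.totalVariation + μ.im.totalVariation)
    (VectorMeasure.variation_le_of_forall_enorm_le fun E _ => ?_)
  have h : ‖μ E‖ₑ ≤ ‖μ.re E‖ₑ + ‖μ.im E‖ₑ := by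
    have h1 : μ E = (μ.re E : ℂ) + (μ.im E : ℂ) * Complex.I := (Complex.re_add_im (μ E)).symm
    rw [h1]
    refine (enorm_add_le _ _).trans (le_of_eq ?_)
    simp [← ofReal_norm]
  exact h.trans (add_le_add (SignedMeasure.enorm_le_totalVariation _ _)
    (SignedMeasure.enorm_le_totalVariation _ _))

/-- Integration against a complex measure as a bounded functional on `L¹` of its variation. -/
theorem exists_integral_clm (μ : ComplexMeasure X) :
    ∃ Λ : Lp ℂ 1 μ.variation →L[ℂ] ℂ, ∀ f,
      Λ f = μ.integral f (ContinuousLinearMap.mul ℝ ℂ) := by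
  refine ⟨LinearMap.mkContinuous
    { toFun := fun f => μ.integral f (ContinuousLinearMap.mul ℝ ℂ)
      map_add' := fun f g => ?_
      map_smul' := fun c f => ?_ } ‖ContinuousLinearMap.mul ℝ ℂ‖ fun f => ?_, fun f => rfl⟩
  · rw [VectorMeasure.integral_congr_ae (Lp.coeFn_add f g)]
    exact VectorMeasure.integral_add (L1.integrable_coeFn f) (L1.integrable_coeFn g)
  · rw [VectorMeasure.integral_congr_ae (Lp.coeFn_smul c f)]
    -- The integral is built from an ℝ-bilinear pairing, so complex homogeneity has to be checked on
    -- the set function `x ↦ x * μ s`, where it is associativity.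
    refine setToFun_smul _ (fun c s x => ?_) c _
    exact mul_assoc c x (μ s)
  · exact norm_setToFun_le_mul_norm _ f (ContinuousLinearMap.opNorm_nonneg _)

end Variation

/-! ### Weak almost periodicity by factoring through L². -/

section UniformAlgebra

/-- Functionals that extend to `L¹` of a finite measure are weakly almost periodic on every
algebra of bounded continuous functions with a norm that dominates the supremum norm. -/
theorem mem_wap_of_factor_L1 {X : Type*} [TopologicalSpace X] [MeasurableSpace X] [BorelSpace X]
    (ν : Measure X) [IsFiniteMeasure ν] (Λ : Lp ℂ 1 ν →L[ℂ] ℂ)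
    {A : Type*} [NormedCommRing A] [NormedAlgebra ℂ A] (ι : A →ₐ[ℂ] (X →ᵇ ℂ))
    (hι : ∀ u, ‖ι u‖ ≤ ‖u‖) :
    ∃ φ ∈ wap A, ∀ u, φ u = Λ (BoundedContinuousFunction.toLp 1 ν ℂ (ι u)) := by
  let I : A →L[ℂ] (X →ᵇ ℂ) := LinearMap.mkContinuous ι.toLinearMap 1 fun u => by
    simpa using hι u
  let φ : StrongDual ℂ A := Λ ∘L BoundedContinuousFunction.toLp 1 ν ℂ ∘L I
  let T : A →L[ℂ] Lp ℂ 2 ν := BoundedContinuousFunction.toLp 2 ν ℂ ∘L I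
  let P : Lp ℂ 2 ν →L[ℂ] Lp ℂ 2 ν →L[ℂ] Lp ℂ 1 ν :=
    (ContinuousLinearMap.mul ℂ ℂ).holderL ν 2 2 1
  -- S(w) is the functional v ↦ Λ(w · Tv), with `P` the Hölder product L² × L² → L¹.
  let S : Lp ℂ 2 ν →L[ℂ] StrongDual ℂ A :=
    (ContinuousLinearMap.compL ℂ A (Lp ℂ 1 ν) ℂ Λ) ∘L
      ((ContinuousLinearMap.compL ℂ A (Lp ℂ 2 ν) (Lp ℂ 1 ν)).flip T) ∘L P
  -- The factorization of the orbit map: the L¹ class of uv is the Hölder product of the L² classes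
  -- of u and v, because `ι` is multiplicative.
  have hS : ∀ u, dualAct φ u = S (T u) := fun u => by
    ext v
    change Λ (BoundedContinuousFunction.toLp 1 ν ℂ (ι (u * v))) =
      Λ ((ContinuousLinearMap.mul ℂ ℂ).holder 1 (BoundedContinuousFunction.toLp 2 ν ℂ (ι u))
        (BoundedContinuousFunction.toLp 2 ν ℂ (ι v)))
    congr 1
    apply Lp.ext
    filter_upwards [BoundedContinuousFunction.coeFn_toLp ν (p := 1) (𝕜 := ℂ) (ι (u * v)),
      BoundedContinuousFunction.coeFn_toLp ν (p := 2) (𝕜 := ℂ) (ι u),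
      BoundedContinuousFunction.coeFn_toLp ν (p := 2) (𝕜 := ℂ) (ι v),
      (ContinuousLinearMap.mul ℂ ℂ).coeFn_holder (r := 1)
        (BoundedContinuousFunction.toLp 2 ν ℂ (ι u))
        (BoundedContinuousFunction.toLp 2 ν ℂ (ι v))] with x h1 h2 h3 h4
    rw [h1, h4, h2, h3, map_mul]
    rfl
  refine ⟨φ, ?_, fun u => rfl⟩
  -- The radius is ‖T‖ because T maps the unit ball of `A` into that ball.
  have hK := isCompact_toWeakSpace_image_closedBall S ‖T‖
  refine hK.closure_of_subset (Set.image_mono ?_)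
  rintro _ ⟨u, hu, rfl⟩
  refine ⟨T u, ?_, (hS u).symm⟩
  simpa using T.le_of_opNorm_le_of_le le_rfl hu

end UniformAlgebra

/-! ### The multiplier norm and the supremum norm. -/

section SupNorm

variable {G : Type*} [Group G] [TopologicalSpace G] [IsTopologicalGroup G]
  [MeasurableSpace G] [BorelSpace G]
  {lam : Measure G} [lam.IsHaarMeasure] {p q : ℝ≥0∞} [p.HolderConjugate q]

/-- Evaluation at a point as a bounded functional on the Herz algebra. -/
noncomputable def Ap.eval (x : G) : Ap lam p q →L[ℂ] ℂ :=
  LinearMap.mkContinuous ((LinearMap.proj x).comp Ap.toFun) 1 fun v => by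
    simpa using Ap.norm_toFun_le v x

theorem Ap.eval_apply (x : G) (v : Ap lam p q) : Ap.eval x v = Ap.toFun v x := rfl

/-- The multiplier norm dominates the supremum norm: `u(x)` is an eigenvalue of the adjoint of
multiplication by `u`, with the evaluation at `x` as an eigenvector. -/
theorem Bp.norm_toBCF_le [LocallyCompactSpace G] (u : Bp lam p q) : ‖Bp.toBCF u‖ ≤ ‖u‖ := by
  refine (BoundedContinuousFunction.norm_le (norm_nonneg u)).2 fun x => ?_
  -- The eigenvector must be nonzero for its norm to cancel: some element of `Ap` does not vanish at
  -- `x`.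
  have h0 : 0 < ‖(Ap.eval x : Ap lam p q →L[ℂ] ℂ)‖ := by
    obtain ⟨v, hv⟩ := Ap.exists_toFun_ne_zero (lam := lam) (p := p) (q := q) x
    exact norm_pos_iff.2 fun h => hv (by rw [← Ap.eval_apply, h]; rfl)
  have h : (Ap.eval x).comp (Bp.mulCLM u) = u x • (Ap.eval x : Ap lam p q →L[ℂ] ℂ) := rfl
  refine le_of_mul_le_mul_right ?_ h0
  rw [← norm_smul, ← h, mul_comm]
  exact ContinuousLinearMap.opNorm_comp_le _ _

end SupNorm

end Herz

/-- Every complex Borel measure on `G` acts on `B_p(G)` as a weakly almost periodic functional. -/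
theorem proposition3p6 {G : Type*} [Group G] [TopologicalSpace G] [IsTopologicalGroup G]
    [LocallyCompactSpace G] [T2Space G] [MeasurableSpace G] [BorelSpace G]
    (lam : Measure G) [lam.IsHaarMeasure] [lam.Regular]
    (p q : ℝ≥0∞) (hp : 1 < p) (hp' : p < ∞) [p.HolderConjugate q]
    (μ : ComplexMeasure G) :
    ∃ φ ∈ Herz.wap (Herz.Bp lam p q), ∀ u : Herz.Bp lam p q,
      μ.Integrable (fun x => u x) ∧
        φ u = μ.integral (fun x => u x) (ContinuousLinearMap.mul ℝ ℂ) := by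
  have := Herz.isFiniteMeasure_variation_complexMeasure μ
  obtain ⟨Λ, hΛ⟩ := Herz.exists_integral_clm μ
  obtain ⟨φ, hφ, h⟩ := Herz.mem_wap_of_factor_L1 μ.variation Λ
    (Herz.Bp.toBCF (lam := lam) (p := p) (q := q)) Herz.Bp.norm_toBCF_le
  refine ⟨φ, hφ, fun u => ⟨(Herz.Bp.toBCF u).integrable _, ?_⟩⟩
  rw [h, hΛ]
  -- Λ integrates a representative of the L¹ class of `u`, which agrees with `u` almost everywhere
  -- for the variation of μ.
  exact VectorMeasure.integral_congr_ae (BoundedContinuousFunction.coeFn_toLp _ _ _ _)
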